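/- **Definitions.** Let $B$ be a real Banach space and $\alpha\ge 0$. A nonempty closed set $P\subset B$ is *$\alpha$-paraconvex* if for every open ball $D_r\subset B$ of radius $r>0$ one has $\operatorname{dist}(q,P)\le \alpha r$ for all $q\in\operatorname{conv}(P\cap D_r)$. For $m\ge1$ let $\Delta_m=\{t\in[0,1]^m:\sum_i t_i=1\}$, and for an $m$-tuple $z$ ($m\ge 2$) let $\partial_i z$ be the $(m-1)$-tuple obtained by omitting the $i$-th entry. A *convex metric structure* (in the sense of E. Michael) on a metric space $(E,\rho)$ consists of sets $M_m\subset E^m$ and maps $k_m:M_m\times \Delta_m\to E$, $m\ge1$, such that 1. $M_1=E$ and $k_1(x,1)=x$; 2. if $x\in M_m$, $m\ge2$, $1\le i\le m$, then $\partial_i x\in M_{m-1}$, and if $t\in\Delta_m$ has $t_i=0$, then $k_m(x,t)=k_{m-1}(\partial_i x,\partial_i t)$; 3. if $x\in M_m$, $m\ge2$, $1\le i<m$, $x_i=x_{i+1}$ and $t\in\Delta_m$, then $k_m(x,t)=k_{m-1}(\partial_{i+1} x,(t_1,\dots,t_{i-1},t_i+t_{i+1},t_{i+2},\dots,t_m))$;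 4. for each $x\in M_m$ the map $t\mapsto k_m(x,t)$ is continuous; 5. for each $\varepsilon>0$ there is a neighborhood $V$ of the diagonal in $E\times E$ such that for all $m$, all $x,y\in M_m$ with $(x_i,y_i)\in V$ for $i=1,\dots,m$, and all $t\in\Delta_m$, one has $\rho(k_m(x,t),k_m(y,t))<\varepsilon$. A set $A\subset E$ is *convex* with respect to this structure if $A^m\subset M_m$ and $k_m(A^m\times \Delta_m)\subset A$ for all $m\ge1$. **Corollary 2.6.** Let $0\le\alpha<\frac12$, let $Y$ be a subset of a real Banach space $B$ with the induced metric, let $X$ be a topological space, and let $f:Y\to X$ be a continuous surjection such that every point-inverse $f^{-1}(x)$, $x\in X$, is compact and $\alpha$-paraconvex in $B$, and such that the mapping $x\mapsto f^{-1}(x)$ is continuous with respect to the Hausdorff metric. Then $Y$ admits a convex metric structure with respect to which every point-inverse $f^{-1}(x)$, $x\in X$, is convex. -/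

import Mathlib

open Set Filter Topology

/-- A subset `P` of a normed space is `α`-paraconvex: it is nonempty and closed, and for every open
ball `D` of radius `r`, every point of the convex hull of `P ∩ D` is at distance at most `α * r`
from `P`. -/
def IsParaconvex {B : Type*} [NormedAddCommGroup B] [NormedSpace ℝ B] (α : ℝ) (P : Set B) : Prop :=
  P.Nonempty ∧ IsClosed P ∧
    ∀ (c : B) (r : ℝ), 0 < r → ∀ q ∈ convexHull ℝ (P ∩ Metric.ball c r), Metric.infDist q P ≤ α * r

/-- Continuity, with respect to the Hausdorff distance, of a set-valued mapping (used for mappings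
whose values are nonempty and compact, where the Hausdorff distance is a genuine metric). -/
def HausdorffContinuous {X B : Type*} [TopologicalSpace X] [PseudoMetricSpace B]
    (F : X → Set B) : Prop :=
  ∀ x : X, Tendsto (fun x' => Metric.hausdorffDist (F x') (F x)) (𝓝 x) (𝓝 0)

/-- A convex metric structure, in the sense of E. Michael, on a metric space `E`.

The domain `M_m ⊆ E ^ m` (`m ≥ 1`) of the `m`-ary convex combinations is `M n` with `m = n + 1`, and
`k n x t` is the convex combination of the points `x 0, …, x n` with the weights `t 0, …, t n`. It
is meaningful for `x ∈ M n` and `t` in the standard simplex; its other values are irrelevant, and no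
condition is put on them. -/
structure ConvexMetricStructure (E : Type*) [PseudoMetricSpace E] where
  /-- The tuples of points whose convex combinations are defined. -/
  M : ∀ n : ℕ, Set (Fin (n + 1) → E)
  /-- The convex combinations. -/
  k : ∀ n : ℕ, (Fin (n + 1) → E) → (Fin (n + 1) → ℝ) → E
  /-- Every point has its combinations defined, … -/
  one_mem : ∀ x : Fin 1 → E, x ∈ M 0
  /-- … and it is its own convex combination with weight `1`. -/
  one_eq : ∀ x ∈ M 0, ∀ t ∈ stdSimplex ℝ (Fin 1), k 0 x t = x 0
  /-- Omitting a point from an admissible tuple leaves an admissible tuple. -/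
  face_mem : ∀ (n : ℕ), ∀ x ∈ M (n + 1), ∀ i : Fin (n + 2), i.removeNth x ∈ M n
  /-- A point with weight `0` may be omitted. -/
  face_eq : ∀ (n : ℕ), ∀ x ∈ M (n + 1), ∀ i : Fin (n + 2), ∀ t ∈ stdSimplex ℝ (Fin (n + 2)),
    t i = 0 → k (n + 1) x t = k n (i.removeNth x) (i.removeNth t)
  /-- Two equal consecutive points may be merged, and their weights added. -/
  merge_eq : ∀ (n : ℕ), ∀ x ∈ M (n + 1), ∀ i : Fin (n + 1), x i.castSucc = x i.succ →
    ∀ t ∈ stdSimplex ℝ (Fin (n + 2)),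
      k (n + 1) x t = k n (i.succ.removeNth x)
        (Function.update (i.succ.removeNth t) i (t i.castSucc + t i.succ))
  /-- Convex combinations depend continuously on the weights. -/
  continuousOn_weights : ∀ (n : ℕ), ∀ x ∈ M n,
    ContinuousOn (k n x) (stdSimplex ℝ (Fin (n + 1)))
  /-- For every `ε > 0` there is a neighborhood `V` of the diagonal such that two combinations, with
  the same number of points and the same weights, of `V`-close points are `ε`-close. -/
  close : ∀ ε : ℝ, 0 < ε → ∃ V ∈ 𝓝ˢ (diagonal E), ∀ (n : ℕ), ∀ x ∈ M n, ∀ y ∈ M n,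
    (∀ i, (x i, y i) ∈ V) → ∀ t ∈ stdSimplex ℝ (Fin (n + 1)), dist (k n x t) (k n y t) < ε

/-- A set is convex with respect to a convex metric structure if all convex combinations of its
points are defined and belong to it. -/
def ConvexMetricStructure.IsConvex {E : Type*} [PseudoMetricSpace E]
    (S : ConvexMetricStructure E) (A : Set E) : Prop :=
  ∀ (n : ℕ) (x : Fin (n + 1) → E), (∀ i, x i ∈ A) →
    x ∈ S.M n ∧ ∀ t ∈ stdSimplex ℝ (Fin (n + 1)), S.k n x t ∈ A

/-! Average linearly in `B`, then retract onto the fibre: a tuple is admissible when it lies in one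
fibre over some `a`, and `k n x t` is `R (F a, ∑ i, t i • x i)`, where `R` retracts onto paraconvex
compacta, continuously in the set and the point together. The algebraic axioms come from linear sums
and from `R` fixing its target. Such an `R` is a selection over the metrizable, hence paracompact,
space of pairs `(P, x)`, for the mapping with value `{x}` if `x ∈ P` and `P` otherwise. Michael's
iteration gives it: paraconvexity shrinks the error of an approximate selection by a fixed factor,
with steps dominated by a geometric series. Closeness must hold for all tuple lengths at once.
Averaging does not increase distances, and `R` is uniformly continuous near the closed convex hull
of a fibre, which is compact by Mazur's theorem. -/

/-- The distance from a point to a nonempty compact set depends continuously on both. -/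
theorem Continuous.infDist_nonemptyCompacts {Q M : Type*} [TopologicalSpace Q] [MetricSpace M]
    {g : Q → M} {P : Q → TopologicalSpace.NonemptyCompacts M} (hg : Continuous g)
    (hP : Continuous P) : Continuous fun q => Metric.infDist (g q) (P q : Set M) := by
  have h := (Metric.lipschitz_infDist (α := M)).continuous.comp (hg.prodMk hP)
  exact h

/-! ### Selections and retractions for paraconvex values -/

section ParaconvexSelection

variable {B : Type*} [NormedAddCommGroup B] [NormedSpace ℝ B]

theorem isParaconvex_singleton {α : ℝ} (hα : 0 ≤ α) (x : B) : IsParaconvex α ({x} : Set B) := by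
  refine ⟨singleton_nonempty x, isClosed_singleton, fun c r hr q hq => ?_⟩
  have hqx : q ∈ ({x} : Set B) :=
    convexHull_min inter_subset_left (convex_singleton x) hq
  rw [Metric.infDist_zero_of_mem hqx]
  positivity

/-- The distance to a paraconvex set of the convex combinations of points near that part of the
set which lies in a ball. -/
theorem IsParaconvex.infDist_lt {α : ℝ} {P : Set B} (hP : IsParaconvex α P) {c : B} {r δ : ℝ}
    (hr : 0 < r) (hδ : 0 < δ) {q : B}
    (hq : q ∈ convexHull ℝ ({y | Metric.infDist y P < δ} ∩ Metric.ball c r)) :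
    Metric.infDist q P < δ + α * (r + δ) := by
  have hsub : {y | Metric.infDist y P < δ} ∩ Metric.ball c r ⊆
      Metric.thickening δ (convexHull ℝ (P ∩ Metric.ball c (r + δ))) := by
    rintro y ⟨hy, hyc⟩
    obtain ⟨p, hp, hyp⟩ := (Metric.infDist_lt_iff hP.1).1 hy
    refine Metric.mem_thickening_iff.2 ⟨p, subset_convexHull ℝ _ ⟨hp, ?_⟩, hyp⟩
    rw [Metric.mem_ball] at hyc ⊢
    linarith [dist_triangle_left p c y]
  obtain ⟨p, hp, hqp⟩ := Metric.mem_thickening_iff.1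
    (convexHull_min hsub ((convex_convexHull ℝ _).thickening δ) hq)
  linarith [hP.2.2 c (r + δ) (by linarith) p hp, Metric.infDist_le_infDist_add_dist (s := P)
    (x := q) (y := p)]

variable {Z : Type*} [TopologicalSpace Z] [NormalSpace Z] [ParacompactSpace Z]

/-- An approximate selection of a lower semicontinuous mapping with paraconvex values can be
improved by a factor, at a cost controlled by its error. -/
theorem exists_better_approximate_selection {α : ℝ} (hα : α < 1) {Φ : Z → Set B}
    (hΦ : ∀ z, IsParaconvex α (Φ z))
    (hlsc : ∀ z, ∀ y ∈ Φ z, ∀ ε > 0, ∀ᶠ z' in 𝓝 z, Metric.infDist y (Φ z') < ε)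
    (g : C(Z, B)) (r : C(Z, ℝ)) (hr : ∀ z, 0 < r z) (hg : ∀ z, Metric.infDist (g z) (Φ z) < r z) :
    ∃ g' : C(Z, B), ∀ z, dist (g z) (g' z) < r z ∧
      Metric.infDist (g' z) (Φ z) < (1 + α) / 2 * r z := by
  -- The new error is `(η + α * (1 + η)) * r z`, which falls short of `(1 + α) / 2 * r z` by `(1 -
  -- α) ^ 2 / 4 * r z`.
  set η : ℝ := (1 - α) / 4 with hη
  have hη0 : 0 < η := by rw [hη]; linarith
  obtain ⟨g', hg'⟩ := exists_continuous_forall_mem_convex_of_local_const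
    (t := fun z => convexHull ℝ
      ({y | Metric.infDist y (Φ z) < η * r z} ∩ Metric.ball (g z) (r z)))
    (fun z => convex_convexHull ℝ _) (by
      intro z
      -- By lower semicontinuity, one point of `Φ z` close to `g z` serves a whole neighborhood; a
      -- partition of unity glues these constants.
      obtain ⟨c, hc, hcz⟩ := (Metric.infDist_lt_iff (hΦ z).1).1 (hg z)
      refine ⟨c, ?_⟩
      have h₁ : ∀ᶠ z' in 𝓝 z, dist c (g z') < r z' := by
        rw [dist_comm] at hcz
        exact (Continuous.continuousAt (by fun_prop)).eventually_lt r.continuous.continuousAt hcz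
      have h₂ : ∀ᶠ z' in 𝓝 z, r z / 2 < r z' :=
        continuousAt_const.eventually_lt r.continuous.continuousAt (half_lt_self (hr z))
      filter_upwards [h₁, h₂, hlsc z c hc (η * (r z / 2)) (mul_pos hη0 (half_pos (hr z)))]
        with z' h₁ h₂ h₃
      exact subset_convexHull ℝ _ ⟨h₃.trans (mul_lt_mul_of_pos_left h₂ hη0), h₁⟩)
  refine ⟨g', fun z => ⟨?_, ?_⟩⟩
  · have := convexHull_min inter_subset_right (convex_ball (g z) (r z)) (hg' z)
    rwa [Metric.mem_ball'] at this
  · refine ((hΦ z).infDist_lt (hr z) (mul_pos hη0 (hr z)) (hg' z)).trans_le ?_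
    rw [hη]
    nlinarith [mul_nonneg (hr z).le (sq_nonneg (1 - α))]

/-- Michael's selection theorem for paraconvex-valued mappings, starting from an approximate
selection. -/
theorem exists_continuous_selection_of_isParaconvex [CompleteSpace B] {α : ℝ} (hα0 : 0 ≤ α)
    (hα : α < 1) {Φ : Z → Set B} (hΦ : ∀ z, IsParaconvex α (Φ z))
    (hlsc : ∀ z, ∀ y ∈ Φ z, ∀ ε > 0, ∀ᶠ z' in 𝓝 z, Metric.infDist y (Φ z') < ε)
    (g : C(Z, B)) (r : C(Z, ℝ)) (hr : ∀ z, 0 < r z) (hg : ∀ z, Metric.infDist (g z) (Φ z) < r z) :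
    ∃ s : C(Z, B), ∀ z, s z ∈ Φ z := by
  set β : ℝ := (1 + α) / 2 with hβ
  have hβ0 : 0 < β := by rw [hβ]; linarith
  have hβ1 : β < 1 := by rw [hβ]; linarith
  let ρ : ℕ → C(Z, ℝ) := fun n => ⟨fun z => r z * β ^ n, by fun_prop⟩
  have step : ∀ (n : ℕ) (u : {u : C(Z, B) // ∀ z, Metric.infDist (u z) (Φ z) < ρ n z}),
      ∃ v : {v : C(Z, B) // ∀ z, Metric.infDist (v z) (Φ z) < ρ (n + 1) z},
        ∀ z, dist (u.1 z) (v.1 z) ≤ r z * β ^ n := by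
    intro n u
    obtain ⟨v, hv⟩ := exists_better_approximate_selection hα hΦ hlsc u.1 (ρ n)
      (fun z => mul_pos (hr z) (pow_pos hβ0 n)) u.2
    refine ⟨⟨v, fun z => (hv z).2.trans_eq ?_⟩, fun z => (hv z).1.le⟩
    simp only [ρ, ContinuousMap.coe_mk, ← hβ]
    ring
  choose next hnext using step
  let u : ∀ n, {u : C(Z, B) // ∀ z, Metric.infDist (u z) (Φ z) < ρ n z} := fun n =>
    Nat.rec ⟨g, fun z => by simpa [ρ] using hg z⟩ (fun n u => next n u) n
  have hu : ∀ z n, dist ((u n).1 z) ((u (n + 1)).1 z) ≤ r z * β ^ n := fun z n => hnext n (u n) z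
  choose s hs using fun z => cauchySeq_tendsto_of_complete
    (cauchySeq_of_le_geometric β (r z) hβ1 (hu z))
  have hdist : ∀ z n, dist ((u n).1 z) (s z) ≤ r z * β ^ n / (1 - β) := fun z n =>
    dist_le_of_le_geometric_of_tendsto β (r z) hβ1 (hu z) (hs z) n
  have htend : ∀ c : ℝ, Tendsto (fun n : ℕ => c * β ^ n / (1 - β)) atTop (𝓝 0) := fun c => by
    simpa using ((tendsto_pow_atTop_nhds_zero_of_lt_one hβ0.le hβ1).const_mul c).div_const (1 - β)
  have hunif : TendstoLocallyUniformly (fun n z => (u n).1 z) s atTop := by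
    rw [Metric.tendstoLocallyUniformly_iff]
    intro ε hε z
    -- The geometric bound is uniform only where `r` is bounded.
    refine ⟨{z' | r z' < r z + 1},
      r.continuous.continuousAt.eventually_lt continuousAt_const (lt_add_one _), ?_⟩
    filter_upwards [(htend (r z + 1)).eventually_lt_const hε] with n hn z' hz'
    rw [dist_comm]
    refine (hdist z' n).trans_lt (lt_of_le_of_lt ?_ hn)
    have : 0 < 1 - β := by linarith
    have : r z' ≤ r z + 1 := le_of_lt hz'
    gcongr
  refine ⟨⟨s, hunif.continuous (Frequently.of_forall fun n => (u n).1.continuous)⟩, fun z => ?_⟩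
  rw [ContinuousMap.coe_mk, (hΦ z).2.1.mem_iff_infDist_zero (hΦ z).1]
  have h₁ : Tendsto (fun n => Metric.infDist ((u n).1 z) (Φ z)) atTop
      (𝓝 (Metric.infDist (s z) (Φ z))) :=
    ((Metric.continuous_infDist_pt (Φ z)).tendsto (s z)).comp (hs z)
  have h₂ : Tendsto (fun n : ℕ => r z * β ^ n) atTop (𝓝 0) := by
    simpa using (tendsto_pow_atTop_nhds_zero_of_lt_one hβ0.le hβ1).const_mul (r z)
  exact tendsto_nhds_unique h₁
    (squeeze_zero (fun n => Metric.infDist_nonneg) (fun n => ((u n).2 z).le) h₂)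

/-- A choice of retractions onto the compact `α`-paraconvex sets which is jointly continuous in the
set and in the point. -/
theorem exists_continuous_retraction_onto_isParaconvex [CompleteSpace B] {α : ℝ} (hα0 : 0 ≤ α)
    (hα : α < 1) :
    ∃ R : C({P : TopologicalSpace.NonemptyCompacts B // IsParaconvex α (P : Set B)} × B, B),
      ∀ P x, R (P, x) ∈ (P.1 : Set B) ∧ (x ∈ (P.1 : Set B) → R (P, x) = x) := by
  let Φ : {P : TopologicalSpace.NonemptyCompacts B // IsParaconvex α (P : Set B)} × B → Set B :=
    fun z => {y | y ∈ (z.1.1 : Set B) ∧ (z.2 ∈ (z.1.1 : Set B) → y = z.2)}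
  have hmem : ∀ z, z.2 ∈ (z.1.1 : Set B) → Φ z = {z.2} := by
    intro z hz
    ext y
    refine ⟨fun h => h.2 hz, fun h => ?_⟩
    rw [mem_singleton_iff] at h
    exact ⟨h ▸ hz, fun _ => h⟩
  have hnotMem : ∀ z, z.2 ∉ (z.1.1 : Set B) → Φ z = z.1.1 := fun z hz =>
    ext fun y => ⟨fun h => h.1, fun h => ⟨h, fun h' => absurd h' hz⟩⟩
  have hval : Continuous
      fun z : {P : TopologicalSpace.NonemptyCompacts B // IsParaconvex α (P : Set B)} × B =>
        z.1.1 := continuous_subtype_val.comp continuous_fst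
  have hinf := continuous_snd.infDist_nonemptyCompacts hval
  have hpara : ∀ z, IsParaconvex α (Φ z) := by
    intro z
    by_cases hz : z.2 ∈ (z.1.1 : Set B)
    · rw [hmem z hz]
      exact isParaconvex_singleton hα0 _
    · rw [hnotMem z hz]
      exact z.1.2
  have hlsc : ∀ z, ∀ y ∈ Φ z, ∀ ε > 0, ∀ᶠ z' in 𝓝 z, Metric.infDist y (Φ z') < ε := by
    intro z y hy ε hε
    have hP : ∀ᶠ z' in 𝓝 z, Metric.infDist y (z'.1.1 : Set B) < ε := by
      refine Tendsto.eventually_lt_const (v := Metric.infDist y (z.1.1 : Set B)) ?_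
        ((continuous_const.infDist_nonemptyCompacts hval).tendsto z)
      rwa [Metric.infDist_zero_of_mem hy.1]
    -- If `z.2` lies in the set, then `y = z.2` is close to both possible nearby values. If not, it
    -- stays outside for nearby pairs.
    by_cases hz : z.2 ∈ (z.1.1 : Set B)
    · have hyz := hy.2 hz
      have hd : ∀ᶠ z' in 𝓝 z, dist y z'.2 < ε := by
        refine Tendsto.eventually_lt_const (v := dist y z.2) ?_
          (Continuous.tendsto (by fun_prop) z)
        rwa [hyz, dist_self]
      filter_upwards [hP, hd] with z' h₁ h₂
      by_cases hz' : z'.2 ∈ (z'.1.1 : Set B)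
      · rwa [hmem z' hz', Metric.infDist_singleton]
      · rwa [hnotMem z' hz']
    · have hne : ∀ᶠ z' in 𝓝 z, 0 < Metric.infDist z'.2 (z'.1.1 : Set B) :=
        (hinf.tendsto z).eventually_const_lt
          ((z.1.2.2.1.notMem_iff_infDist_pos z.1.2.1).1 hz)
      filter_upwards [hP, hne] with z' h₁ h₂
      rwa [hnotMem z' ((z'.1.2.2.1.notMem_iff_infDist_pos z'.1.2.1).2 h₂)]
  obtain ⟨s, hs⟩ := exists_continuous_selection_of_isParaconvex hα0 hα hpara hlsc
    ⟨fun z => z.2, continuous_snd⟩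
    -- Adding `1` keeps the radius positive where the point lies in the set.
    ⟨fun z => Metric.infDist z.2 (z.1.1 : Set B) + 1, hinf.add continuous_const⟩
    (fun z => add_pos_of_nonneg_of_pos Metric.infDist_nonneg one_pos) (by
      intro z
      by_cases hz : z.2 ∈ (z.1.1 : Set B)
      · simp [hmem z hz, add_pos_of_nonneg_of_pos Metric.infDist_nonneg one_pos]
      · simp [hnotMem z hz])
  exact ⟨s, fun P x => ⟨(hs (P, x)).1, (hs (P, x)).2⟩⟩

end ParaconvexSelection

/-! ### Uniform continuity near a compact set -/

section UniformContinuity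

/-- A continuous function of a parameter and a point is uniformly continuous in the point near a
compact set, uniformly in nearby parameters. -/
theorem Continuous.exists_dist_lt_near_isCompact {X B B' : Type*} [TopologicalSpace X]
    [PseudoMetricSpace B] [PseudoMetricSpace B'] {G : X × B → B'} (hG : Continuous G) {K : Set B}
    (hK : IsCompact K) (a : X) {ε : ℝ} (hε : 0 < ε) :
    ∃ U ∈ 𝓝 a, ∃ δ > 0, ∀ b ∈ U, ∀ c ∈ U, ∀ p ∈ Metric.thickening δ K, ∀ q, dist p q < δ →
      dist (G (b, p)) (G (c, q)) < ε := by
  refine hK.induction_on (p := fun K => ∃ U ∈ 𝓝 a, ∃ δ > 0, ∀ b ∈ U, ∀ c ∈ U,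
    ∀ p ∈ Metric.thickening δ K, ∀ q, dist p q < δ → dist (G (b, p)) (G (c, q)) < ε) ?_ ?_ ?_ ?_
  · exact ⟨univ, univ_mem, 1, one_pos, by simp⟩
  · rintro s t hst ⟨U, hU, δ, hδ, h⟩
    exact ⟨U, hU, δ, hδ, fun b hb c hc p hp =>
      h b hb c hc p (Metric.thickening_subset_of_subset δ hst hp)⟩
  · rintro s t ⟨U, hU, δ, hδ, h⟩ ⟨U', hU', δ', hδ', h'⟩
    refine ⟨U ∩ U', inter_mem hU hU', min δ δ', lt_min hδ hδ', ?_⟩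
    intro b hb c hc p hp q hpq
    rw [Metric.thickening_union] at hp
    rcases hp with hp | hp
    · exact h b hb.1 c hc.1 p (Metric.thickening_mono (min_le_left _ _) _ hp) q
        (hpq.trans_le (min_le_left _ _))
    · exact h' b hb.2 c hc.2 p (Metric.thickening_mono (min_le_right _ _) _ hp) q
        (hpq.trans_le (min_le_right _ _))
  · intro p₀ _
    have hnear : ∀ᶠ z in 𝓝 (a, p₀), dist (G z) (G (a, p₀)) < ε / 2 :=
      (hG.tendsto (a, p₀)).eventually (Metric.ball_mem_nhds _ (half_pos hε))
    rw [nhds_prod_eq] at hnear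
    obtain ⟨U, hU, W, hW, hUW⟩ := mem_prod_iff.1 hnear
    obtain ⟨η, hη, hηW⟩ := Metric.mem_nhds_iff.1 hW
    refine ⟨Metric.ball p₀ (η / 3), mem_nhdsWithin_of_mem_nhds
      (Metric.ball_mem_nhds _ (by positivity)), U, hU, η / 3, by positivity, ?_⟩
    intro b hb c hc p hp q hpq
    obtain ⟨p₁, hp₁, hpp₁⟩ := Metric.mem_thickening_iff.1 hp
    rw [Metric.mem_ball] at hp₁
    have hpW : p ∈ W := hηW (by
      rw [Metric.mem_ball]; linarith [dist_triangle p p₁ p₀])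
    have hqW : q ∈ W := hηW (by
      rw [Metric.mem_ball]; linarith [dist_triangle p p₁ p₀, dist_triangle_left q p₀ p])
    have h₁ : dist (G (b, p)) (G (a, p₀)) < ε / 2 := hUW (mk_mem_prod hb hpW)
    have h₂ : dist (G (c, q)) (G (a, p₀)) < ε / 2 := hUW (mk_mem_prod hc hqW)
    linarith [dist_triangle_right (G (b, p)) (G (c, q)) (G (a, p₀))]

end UniformContinuity

/-! ### Linear combinations under omission and merging -/

section WeightedSums

variable {B : Type*} [AddCommGroup B] [Module ℝ B]

theorem sum_smul_removeNth {n : ℕ} (x : Fin (n + 2) → B) (t : Fin (n + 2) → ℝ) (i : Fin (n + 2))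
    (hi : t i = 0) : ∑ j, i.removeNth t j • i.removeNth x j = ∑ j, t j • x j := by
  rw [Fin.sum_univ_succAbove _ i, hi, zero_smul, zero_add]
  rfl

theorem sum_smul_merge {n : ℕ} (x : Fin (n + 2) → B) (t : Fin (n + 2) → ℝ) (i : Fin (n + 1))
    (hi : x i.castSucc = x i.succ) :
    ∑ j, Function.update (i.succ.removeNth t) i (t i.castSucc + t i.succ) j • i.succ.removeNth x j
      = ∑ j, t j • x j := by
  have hi' : i.succ.succAbove i = i.castSucc := Fin.succAbove_of_castSucc_lt _ _ Fin.castSucc_lt_succ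
  -- The merged sum is the sum without the `i.succ` term, plus that term added back at index `i`.
  have hupd : ∀ j, Function.update (i.succ.removeNth t) i (t i.castSucc + t i.succ) j •
      i.succ.removeNth x j = t (i.succ.succAbove j) • x (i.succ.succAbove j) +
        if j = i then t i.succ • x i.succ else 0 := by
    intro j
    by_cases hj : j = i
    · subst hj
      simp [Fin.removeNth, hi', hi, add_smul]
    · simp [Fin.removeNth, hj]
  rw [Finset.sum_congr rfl fun j _ => hupd j, Finset.sum_add_distrib, Fin.sum_univ_succAbove _ i.succ,
    add_comm]
  simp

end WeightedSums

/-- The difference is a convex combination of vectors in the ball of radius `δ`, so the bound is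
independent of `n`. -/
theorem dist_sum_smul_lt {B : Type*} [NormedAddCommGroup B] [NormedSpace ℝ B] {n : ℕ}
    {x y : Fin (n + 1) → B} {t : Fin (n + 1) → ℝ} (ht : t ∈ stdSimplex ℝ (Fin (n + 1))) {δ : ℝ}
    (h : ∀ i, dist (x i) (y i) < δ) : dist (∑ i, t i • x i) (∑ i, t i • y i) < δ := by
  rw [dist_eq_norm, ← Finset.sum_sub_distrib, ← mem_ball_zero_iff]
  simp_rw [← smul_sub]
  refine (convex_ball (0 : B) δ).sum_mem (fun i _ => ht.1 i) ht.2 fun i _ => ?_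
  rw [mem_ball_zero_iff, ← dist_eq_norm]
  exact h i

/-! ### The convex metric structure -/

theorem corollary2p6 {B X : Type*} [NormedAddCommGroup B] [NormedSpace ℝ B] [CompleteSpace B]
    [TopologicalSpace X] (Y : Set B) (f : Y → X)
    (hf : Continuous f) (hsurj : Function.Surjective f)
    (α : ℝ) (hα0 : 0 ≤ α) (hα : α < 1 / 2)
    (hcompact : ∀ x : X, IsCompact (f ⁻¹' {x}))
    (hpara : ∀ x : X, IsParaconvex α (Subtype.val '' (f ⁻¹' {x})))
    (hcont : HausdorffContinuous (fun x : X => (Subtype.val '' (f ⁻¹' {x}) : Set B))) :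
    ∃ S : ConvexMetricStructure Y, ∀ x : X, S.IsConvex (f ⁻¹' {x}) := by
  obtain ⟨R, hR⟩ := exists_continuous_retraction_onto_isParaconvex (B := B) hα0
    (hα.trans one_half_lt_one)
  let F : X → {P : TopologicalSpace.NonemptyCompacts B // IsParaconvex α (P : Set B)} := fun a =>
    ⟨⟨⟨Subtype.val '' (f ⁻¹' {a}), (hcompact a).image continuous_subtype_val⟩, (hpara a).1⟩,
      hpara a⟩
  have hF : Continuous F := by
    refine continuous_induced_rng.2 (continuous_iff_continuousAt.2 fun a => ?_)
    exact tendsto_iff_dist_tendsto_zero.2 (hcont a)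
  let G : X × B → B := fun z => R (F z.1, z.2)
  have hG : Continuous G :=
    R.continuous.comp ((hF.comp continuous_fst).prodMk continuous_snd)
  have hGmem : ∀ a p, G (a, p) ∈ Subtype.val '' (f ⁻¹' {a}) := fun a p => (hR (F a) p).1
  have hGfix : ∀ y : Y, G (f y, y) = y := fun y => (hR (F (f y)) y).2 ⟨y, rfl, rfl⟩
  choose K hKf hKG using hGmem
  have hunif : ∀ ε > 0, ∀ a, ∃ U ∈ 𝓝 a, ∃ δ > 0, ∀ b ∈ U, ∀ c ∈ U,
      ∀ p ∈ convexHull ℝ (Subtype.val '' (f ⁻¹' {b}) : Set B), ∀ q, dist p q < δ →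
        dist (G (b, p)) (G (c, q)) < ε := by
    intro ε hε a
    have hC : IsCompact (closure (convexHull ℝ (Subtype.val '' (f ⁻¹' {a}) : Set B))) :=
      TotallyBounded.isCompact_of_isClosed (totallyBounded_convexHull.2
        ((hcompact a).image continuous_subtype_val).totallyBounded).closure isClosed_closure
    obtain ⟨U, hU, δ, hδ, h⟩ := hG.exists_dist_lt_near_isCompact hC a hε
    have hnear : ∀ᶠ b in 𝓝 a, dist (F b).1 (F a).1 < δ :=
      (hcont a).eventually_lt_const hδ
    refine ⟨_, inter_mem hU hnear, δ, hδ, fun b hb c hc p hp q hpq =>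
      h b hb.1 c hc.1 p ?_ q hpq⟩
    rw [Metric.thickening_closure]
    -- The thickening of a convex set is convex, so it suffices to place the nearby fibre itself in
    -- it.
    refine convexHull_min (fun y hy => ?_) ((convex_convexHull ℝ _).thickening δ) hp
    obtain ⟨y', hy', hyy'⟩ := Metric.exists_dist_lt_of_hausdorffDist_lt
      (s := ((F b).1 : Set B)) (t := ((F a).1 : Set B)) hy hb.2
      (Metric.hausdorffEDist_ne_top_of_nonempty_of_bounded (F b).1.nonempty (F a).1.nonempty
        (F b).1.isCompact.isBounded (F a).1.isCompact.isBounded)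
    exact Metric.mem_thickening_iff.2 ⟨y', subset_convexHull ℝ _ hy', hyy'⟩
  let S : ConvexMetricStructure Y :=
    { M := fun n => {x | ∀ i j, f (x i) = f (x j)}
      k := fun n x t => K (f (x 0)) (∑ i, t i • (x i : B))
      one_mem := fun x i j => congrArg (fun i => f (x i)) (Subsingleton.elim (α := Fin 1) i j)
      one_eq := by
        intro x _ t ht
        have ht0 : t 0 = 1 := by simpa using ht.2
        apply Subtype.ext
        rw [hKG]
        simp [ht0, hGfix]
      face_mem := fun n x hx i j j' => hx _ _
      face_eq := by
        intro n x hx i t ht hi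
        -- Omitting a point can change the entry at `0`, but not its fibre.
        rw [← sum_smul_removeNth (fun i => (x i : B)) t i hi, hx 0 (i.succAbove 0)]
        rfl
      merge_eq := by
        intro n x hx i hi t ht
        rw [← sum_smul_merge (fun i => (x i : B)) t i (congrArg _ hi),
          hx 0 (i.succ.succAbove 0)]
        rfl
      continuousOn_weights := by
        intro n x hx
        refine (Topology.IsInducing.subtypeVal.continuous_iff.2 ?_).continuousOn
        have : (Subtype.val ∘ fun t : Fin (n + 1) → ℝ => K (f (x 0)) (∑ i, t i • (x i : B))) =
            fun t => G (f (x 0), ∑ i, t i • (x i : B)) := funext fun t => hKG _ _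
        rw [this]
        exact hG.comp (by fun_prop)
      close := by
        intro ε hε
        choose U hU δ hδ h using hunif ε hε
        refine ⟨⋃ a, {z : Y × Y | (f z.1 ∈ U a ∧ f z.2 ∈ U a) ∧ dist z.1 z.2 < δ a}, ?_, ?_⟩
        · refine mem_nhdsSet_iff_forall.2 ?_
          rintro ⟨y, _⟩ (rfl : y = _)
          refine mem_of_superset ?_ (subset_iUnion _ (f y))
          have h₁ : ∀ᶠ z in 𝓝 (y, y), f z.1 ∈ U (f y) :=
            (hf.comp continuous_fst).continuousAt (x := (y, y)) (hU (f y))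
          have h₂ : ∀ᶠ z in 𝓝 (y, y), f z.2 ∈ U (f y) :=
            (hf.comp continuous_snd).continuousAt (x := (y, y)) (hU (f y))
          have h₃ : ∀ᶠ z : Y × Y in 𝓝 (y, y), dist z.1 z.2 < δ (f y) := by
            refine Tendsto.eventually_lt_const (v := dist y y) ?_
              (continuous_dist.tendsto (y, y))
            rw [dist_self]
            exact hδ (f y)
          exact (h₁.and h₂).and h₃
        · intro n x hx y hy hxy t ht
          choose a ha using fun i => mem_iUnion.1 (hxy i)
          -- Different indices may use different centers `a i`. The center with the largest `δ`
          -- controls all the distances, and its `U` contains the base points of both tuples, since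
          -- each tuple lies in one fibre.
          obtain ⟨m, hm⟩ := Finite.exists_max fun i => δ (a i)
          rw [Subtype.dist_eq, hKG, hKG, hx 0 m, hy 0 m]
          refine h (a m) _ (ha m).1.1 _ (ha m).1.2 _ ?_ _
            (dist_sum_smul_lt ht fun i => (ha i).2.trans_le (hm i))
          exact (convex_convexHull ℝ _).sum_mem (fun i _ => ht.1 i) ht.2 fun i _ =>
            subset_convexHull ℝ _ ⟨x i, hx i m, rfl⟩ }
  refine ⟨S, fun a n x hx => ⟨fun i j => (hx i).trans (hx j).symm, fun t _ => ?_⟩⟩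
  have h0 : f (x 0) = a := hx 0
  exact (hKf (f (x 0)) _).trans h0
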